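/- Let $d,r,k$ be integers with $r\ge 0$ and $1\le k\le d$. Let $M_d(\mathbb P^r)=\mathbb P^{(d+1)(r+1)-1}$ be the complex projective space, with the Zariski topology, whose points are the $(r+1)$-tuples $(f_0,\dots,f_r)$, not all zero, of complex binary forms $f_i(x,y)=\sum_{j=0}^d s_{ij}x^{d-j}y^j$ of degree $d$, modulo homothety (so the $s_{ij}$ are the homogeneous coordinates). Let $R_k\subseteq M_d(\mathbb P^r)$ be the set of those $[f_0:\dots:f_r]$ for which $f_0,\dots,f_r$ have at least $d-k+1$ common roots in $\mathbb P^1$, counted with multiplicities, that is, $\sum_{q\in\mathbb P^1}\min_{0\le i\le r}\operatorname{mult}_q(f_i)\ge d-k+1$, where $\operatorname{mult}_q(f)$ is the order of vanishing of $f$ at $q$ and $\operatorname{mult}_q(0)=\infty$. Then $R_k$ has (Krull) dimension $d+kr$. -/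

import Mathlib

open scoped LinearAlgebra.Projectivization

noncomputable section

/-- The zero locus in `ℙ(ℂ^σ)` of a set `S` of polynomials (used for homogeneous ones, for which
vanishing at a point does not depend on the vector that represents it). -/
def projZeroLocus {σ : Type*} (S : Set (MvPolynomial σ ℂ)) : Set (ℙ ℂ (σ → ℂ)) :=
  {p | ∀ F ∈ S, MvPolynomial.eval p.rep F = 0}

/-- Membership in a zero locus may be tested on any representative of the point. -/
theorem mk_mem_projZeroLocus_iff {σ : Type*} {S : Set (MvPolynomial σ ℂ)}
    (hS : ∀ F ∈ S, ∃ n : ℕ, F.IsHomogeneous n) (v : σ → ℂ) (hv : v ≠ 0) :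
    Projectivization.mk ℂ v hv ∈ projZeroLocus S ↔ ∀ F ∈ S, MvPolynomial.eval v F = 0 := by
  obtain ⟨a, ha⟩ := Projectivization.exists_smul_eq_mk_rep ℂ v hv
  refine forall₂_congr fun F hF => ?_
  obtain ⟨n, hn⟩ := hS F hF
  have key : MvPolynomial.eval ((a : ℂ) • v) F = (a : ℂ) ^ n * MvPolynomial.eval v F := by
    rw [MvPolynomial.eval_eq, MvPolynomial.eval_eq, Finset.mul_sum]
    refine Finset.sum_congr rfl fun e he => ?_
    have hdeg : ∑ i ∈ e.support, e i = n := by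
      have h := hn (MvPolynomial.mem_support_iff.mp he)
      simpa [Finsupp.weight_apply, Finsupp.sum] using h
    simp only [Pi.smul_apply, smul_eq_mul, mul_pow, Finset.prod_mul_distrib,
      Finset.prod_pow_eq_pow_sum, hdeg]
    ring
  rw [← ha, Units.smul_def, key]
  simp

/-- A projective algebraic set: the zero locus of a set of homogeneous polynomials. -/
def IsProjAlgebraicSet {σ : Type*} (Z : Set (ℙ ℂ (σ → ℂ))) : Prop :=
  ∃ S : Set (MvPolynomial σ ℂ), (∀ F ∈ S, ∃ n : ℕ, F.IsHomogeneous n) ∧ Z = projZeroLocus S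

/-- The Zariski topology on `ℙ(ℂ^σ)`: the closed sets are the projective algebraic sets. -/
@[reducible]
def projZariskiTopology (σ : Type*) : TopologicalSpace (ℙ ℂ (σ → ℂ)) :=
  TopologicalSpace.ofClosed {Z | IsProjAlgebraicSet Z}
    ⟨{1}, by
      rintro F rfl
      exact ⟨0, MvPolynomial.isHomogeneous_one σ ℂ⟩, by
      ext p
      simp [projZeroLocus]⟩
    (by
      intro A hA
      refine ⟨{F | (∃ n : ℕ, F.IsHomogeneous n) ∧
        ∃ Z ∈ A, ∀ p ∈ Z, MvPolynomial.eval p.rep F = 0}, fun F hF => hF.1, ?_⟩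
      ext p
      constructor
      · rintro hp F ⟨-, Z, hZ, hF⟩
        exact hF p (hp Z hZ)
      · intro hp Z hZ
        obtain ⟨S, hS, rfl⟩ := hA hZ
        exact fun F hF => hp F ⟨hS F hF, _, hZ, fun q hq => hq F hF⟩)
    (by
      rintro _ ⟨S, hS, rfl⟩ _ ⟨T, hT, rfl⟩
      refine ⟨{H | ∃ F ∈ S, ∃ G ∈ T, H = F * G}, ?_, ?_⟩
      · rintro _ ⟨F, hF, G, hG, rfl⟩
        obtain ⟨m, hm⟩ := hS F hF
        obtain ⟨n, hn⟩ := hT G hG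
        exact ⟨m + n, hm.mul hn⟩
      · ext p
        constructor
        · rintro (hp | hp) _ ⟨F, hF, G, hG, rfl⟩
          · rw [map_mul, hp F hF, zero_mul]
          · rw [map_mul, hp G hG, mul_zero]
        · intro hp
          by_contra hne
          simp only [Set.mem_union, not_or, projZeroLocus, Set.mem_ofPred_eq, not_forall] at hne
          obtain ⟨⟨F, hF, hF0⟩, G, hG, hG0⟩ := hne
          have := hp (F * G) ⟨F, hF, G, hG, rfl⟩
          rw [map_mul] at this
          exact (mul_ne_zero hF0 hG0) this)

/-- The dimension of a subset of `ℙ(ℂ^σ)`: the Krull dimension of the subset as a topological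
space, with the topology induced by the Zariski topology, that is the supremum of the lengths
of chains of its irreducible closed subsets. -/
def projDim {σ : Type*} (Z : Set (ℙ ℂ (σ → ℂ))) : WithBot ℕ∞ :=
  letI : TopologicalSpace (ℙ ℂ (σ → ℂ)) := projZariskiTopology σ
  topologicalKrullDim Z

/-- The binary form `∑ j, c j * x ^ (d - j) * y ^ j` of degree `d`, where `x = X 0`, `y = X 1`. -/
def binaryForm {d : ℕ} (c : Fin (d + 1) → ℂ) : MvPolynomial (Fin 2) ℂ :=
  ∑ j : Fin (d + 1), MvPolynomial.C (c j) *
    (MvPolynomial.X 0 ^ (d - (j : ℕ)) * MvPolynomial.X 1 ^ (j : ℕ))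

/-- The linear form `b x - a y`, which vanishes exactly at the multiples of `v = (a, b)`. -/
def pointForm (v : Fin 2 → ℂ) : MvPolynomial (Fin 2) ℂ :=
  MvPolynomial.C (v 1) * MvPolynomial.X 0 - MvPolynomial.C (v 0) * MvPolynomial.X 1

/-- The multiplicity of the point `q` of `ℙ¹` as a root of `f`: the largest `m` such that
`(b x - a y) ^ m` divides `f`, where `q = [a : b]`. It is `0` if `q` is not a root, and `⊤` if
`f = 0`. -/
def rootMult (f : MvPolynomial (Fin 2) ℂ) (q : ℙ ℂ (Fin 2 → ℂ)) : ℕ∞ :=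
  emultiplicity (pointForm q.rep) f

/-- The multiplicity may be computed with any representative of the point. -/
theorem rootMult_mk (f : MvPolynomial (Fin 2) ℂ) (v : Fin 2 → ℂ) (hv : v ≠ 0) :
    rootMult f (Projectivization.mk ℂ v hv) = emultiplicity (pointForm v) f := by
  obtain ⟨a, ha⟩ := Projectivization.exists_smul_eq_mk_rep ℂ v hv
  have key : pointForm ((a : ℂ) • v) = MvPolynomial.C (a : ℂ) * pointForm v := by
    simp only [pointForm, Pi.smul_apply, smul_eq_mul, map_mul]
    ring
  have hu : IsUnit (MvPolynomial.C (a : ℂ) : MvPolynomial (Fin 2) ℂ) :=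
    a.isUnit.map MvPolynomial.C
  rw [rootMult, ← ha, Units.smul_def, key]
  exact emultiplicity_eq_of_associated_left (associated_unit_mul_left _ _ hu).symm

open Classical in
/-- The forms of a finite family `f` have at least `n` common roots in `ℙ¹`, counted with
multiplicities: there is a multiset of at least `n` points of `ℙ¹` in which each point is
repeated at most as often as its multiplicity as a root of each `f i`. -/
def HasCommonRoots {ι : Type*} (f : ι → MvPolynomial (Fin 2) ℂ) (n : ℕ) : Prop :=
  ∃ D : Multiset (ℙ ℂ (Fin 2 → ℂ)), n ≤ Multiset.card D ∧
    ∀ i q, (D.count q : ℕ∞) ≤ rootMult (f i) q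

/-- The space `M_d(ℙ^r)` of `(r + 1)`-tuples of binary forms of degree `d`, not all zero, modulo
homothety: the projective space of dimension `(d + 1) * (r + 1) - 1` with the coefficients
`s (i, j)` as homogeneous coordinates. -/
abbrev FormTuples (d r : ℕ) : Type := ℙ ℂ (Fin (r + 1) × Fin (d + 1) → ℂ)

/-- The stratum `R_k`: the tuples `[f_0 : ⋯ : f_r]` with at least `d - k + 1` common roots. -/
def stratum (d r k : ℕ) : Set (FormTuples d r) :=
  {s | HasCommonRoots (fun i : Fin (r + 1) => binaryForm fun j => s.rep (i, j)) (d - k + 1)}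

/-- Membership in a stratum may be tested on any representative of the tuple. -/
theorem mk_mem_stratum_iff {d r k : ℕ} (s : Fin (r + 1) × Fin (d + 1) → ℂ) (hs : s ≠ 0) :
    (Projectivization.mk ℂ s hs : FormTuples d r) ∈ stratum d r k ↔
      HasCommonRoots (fun i : Fin (r + 1) => binaryForm fun j => s (i, j)) (d - k + 1) := by
  obtain ⟨a, ha⟩ := Projectivization.exists_smul_eq_mk_rep ℂ s hs
  have hu : IsUnit (MvPolynomial.C (a : ℂ) : MvPolynomial (Fin 2) ℂ) :=
    a.isUnit.map MvPolynomial.C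
  have key : ∀ i, binaryForm (fun j => ((a : ℂ) • s) (i, j)) =
      MvPolynomial.C (a : ℂ) * binaryForm fun j => s (i, j) := by
    intro i
    simp only [binaryForm, Pi.smul_apply, smul_eq_mul, map_mul, Finset.mul_sum, mul_assoc]
  have hm : ∀ i q, rootMult (binaryForm fun j => ((a : ℂ) • s) (i, j)) q =
      rootMult (binaryForm fun j => s (i, j)) q := by
    intro i q
    rw [key]
    exact emultiplicity_eq_of_associated_right (associated_unit_mul_left _ _ hu)
  change HasCommonRoots _ _ ↔ _
  rw [← ha, Units.smul_def]
  simp only [HasCommonRoots, hm]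

end

/-!
The stratum `R_k` consists of the tuples `(g * h_0, …, g * h_r)`, where `g` is a product of
`e = d - k + 1` linear forms and the `h_i` are binary forms of degree `k - 1`
(`mk_factoredTuple_mem_stratum`, `exists_eq_factoredTuple`). If `g` does not vanish at `[0 : 1]`,
its linear factors can be written `b x + y`, the constants being moved into `h`. This leaves
`e + k (r + 1) = d + k r + 1` parameters, which account for the affine cone over `R_k`.

Upper bound. A polynomial relation that holds for the normalized tuples holds on all of `R_k`, since
the factors `b x` with a root at `[0 : 1]` are limits of normalizable ones
(`eval_factoredTuple_eq_zero`). So the homogeneous coordinate ring of the closure of `R_k` embeds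
into a polynomial ring in `d + k r + 1` variables, and by Noether normalization its Krull dimension
is at most `d + k r + 1` (`ringKrullDim_quotient_ker_le`). A chain of irreducible closed subsets of
`R_k` gives a chain of homogeneous primes of that ring, which the ideal of the vertex of the cone
lengthens by one (`projDim_add_one_le_of_ker`).

Lower bound. Order the parameters as `h (0, 0)`, then the `b l`, then the other coefficients of `h`
lexicographically, and let `T_c` be the set of tuples all of whose parameters of rank greater than
`c` vanish. Each `T_c` is irreducible, being the image of a polynomial map
(`isIrreducible_paramImage`), and there is a coordinate that vanishes on `T_i` for all `i < c` but
not identically on `T_c`: as `b x + y` becomes `y` for `b = 0`, letting in one more parameter either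
raises the degree in `x` of the form where it occurs by one or makes that form nonzero. Hence the
closures of `T_0, …, T_{d + k r}` in `R_k` form a strict chain.
-/

attribute [local instance] projZariskiTopology MvPolynomial.gradedAlgebra

/-! ### Krull dimension and parametrizations -/

/-- Primes in an integral extension are incomparable over a given prime, so the dimension of the
extension is at most that of the base. -/
theorem ringKrullDim_le_of_isIntegral {R S : Type*} [CommRing R] [CommRing S] (f : R →+* S)
    (hf : f.IsIntegral) : ringKrullDim S ≤ ringKrullDim R := by
  algebraize [f]
  refine Order.krullDim_le_of_strictMono (PrimeSpectrum.comap (algebraMap R S)) fun I J hIJ => ?_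
  exact Ideal.IsIntegral.comap_lt_comap (R := R) (I := I.asIdeal) (J := J.asIdeal) hIJ

/-- The coordinate ring of a variety that is parametrized by `m` variables has dimension at most
`m`: it is integral over a polynomial ring in `s` variables, and these stay algebraically
independent in the polynomial ring of the parameters. -/
theorem ringKrullDim_quotient_ker_le {K σ τ : Type*} [Field K] [Finite σ] [Finite τ]
    (φ : MvPolynomial σ K →ₐ[K] MvPolynomial τ K) :
    ringKrullDim (MvPolynomial σ K ⧸ RingHom.ker φ) ≤ (Nat.card τ : WithBot ℕ∞) := by
  have : (RingHom.ker φ).IsPrime := RingHom.ker_isPrime φ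
  obtain ⟨s, g, hg, hint⟩ :=
    exists_integral_inj_algHom_of_fg K (MvPolynomial σ K ⧸ RingHom.ker φ)
  have hs : s ≤ Nat.card τ := by
    have h := lift_trdeg_le_of_injective ((Ideal.kerLiftAlg φ).comp g)
      ((Ideal.kerLiftAlg_injective φ).comp hg)
    rw [MvPolynomial.trdeg_of_isDomain, MvPolynomial.trdeg_of_isDomain] at h
    have := Fintype.ofFinite τ
    simpa using h
  refine (ringKrullDim_le_of_isIntegral g.toRingHom hint).trans ?_
  rw [MvPolynomial.ringKrullDim_of_isNoetherianRing, ringKrullDim_eq_zero_of_field]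
  simpa using hs

/-! ### Vanishing ideals of projective sets -/

theorem isClosed_iff_isProjAlgebraicSet {σ : Type*} {Z : Set (ℙ ℂ (σ → ℂ))} :
    IsClosed Z ↔ IsProjAlgebraicSet Z := by
  rw [← isOpen_compl_iff]
  change Zᶜᶜ ∈ {Z | IsProjAlgebraicSet Z} ↔ _
  rw [compl_compl]
  rfl

/-- The affine cone, without its vertex, over a subset of `ℙ(ℂ^σ)`. -/
def puncturedCone {σ : Type*} (Z : Set (ℙ ℂ (σ → ℂ))) : Set (σ → ℂ) :=
  {v | ∃ hv : v ≠ 0, Projectivization.mk ℂ v hv ∈ Z}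

theorem smul_mem_puncturedCone {σ : Type*} {Z : Set (ℙ ℂ (σ → ℂ))} {v : σ → ℂ}
    (hv : v ∈ puncturedCone Z) {a : ℂ} (ha : a ≠ 0) : a • v ∈ puncturedCone Z := by
  obtain ⟨hv0, hv⟩ := hv
  refine ⟨smul_ne_zero ha hv0, ?_⟩
  rwa [(Projectivization.mk_eq_mk_iff' ℂ (a • v) v (smul_ne_zero ha hv0) hv0).2 ⟨a, rfl⟩]

theorem rep_mem_puncturedCone {σ : Type*} {Z : Set (ℙ ℂ (σ → ℂ))} {p : ℙ ℂ (σ → ℂ)}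
    (hp : p ∈ Z) : p.rep ∈ puncturedCone Z :=
  ⟨p.rep_nonzero, by rwa [p.mk_rep]⟩

theorem subset_projZeroLocus_iff {σ : Type*} {Z : Set (ℙ ℂ (σ → ℂ))}
    {S : Set (MvPolynomial σ ℂ)} (hS : ∀ F ∈ S, ∃ n : ℕ, F.IsHomogeneous n) :
    Z ⊆ projZeroLocus S ↔ ∀ F ∈ S, F ∈ MvPolynomial.vanishingIdeal ℂ (puncturedCone Z) := by
  constructor
  · rintro h F hF v ⟨hv, hvZ⟩
    exact (mk_mem_projZeroLocus_iff hS v hv).1 (h hvZ) F hF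
  · intro h p hp F hF
    exact h F hF _ (rep_mem_puncturedCone hp)

theorem MvPolynomial.IsHomogeneous.eval_smul {σ R : Type*} [CommSemiring R]
    {F : MvPolynomial σ R} {n : ℕ} (hF : F.IsHomogeneous n) (a : R) (v : σ → R) :
    MvPolynomial.eval (a • v) F = a ^ n * MvPolynomial.eval v F := by
  rw [MvPolynomial.eval_eq, MvPolynomial.eval_eq, Finset.mul_sum]
  refine Finset.sum_congr rfl fun e he => ?_
  have hdeg : ∑ i ∈ e.support, e i = n := by
    have h := hF (MvPolynomial.mem_support_iff.mp he)
    simpa [Finsupp.weight_apply, Finsupp.sum] using h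
  simp only [Pi.smul_apply, smul_eq_mul, mul_pow, Finset.prod_mul_distrib,
    Finset.prod_pow_eq_pow_sum, hdeg]
  ring

/-- A polynomial that vanishes on a punctured line through the origin has homogeneous components
that vanish there. -/
theorem eval_homogeneousComponent_eq_zero {σ : Type*} {F : MvPolynomial σ ℂ} {v : σ → ℂ}
    (h : ∀ a : ℂ, a ≠ 0 → MvPolynomial.eval (a • v) F = 0) (n : ℕ) :
    MvPolynomial.eval v (MvPolynomial.homogeneousComponent n F) = 0 := by
  -- The values of the components are the coefficients of `a ↦ F (a • v)`.
  set q : Polynomial ℂ := ∑ m ∈ Finset.range (F.totalDegree + 1),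
    Polynomial.monomial m (MvPolynomial.eval v (MvPolynomial.homogeneousComponent m F)) with hq
  have hqe : ∀ a : ℂ, q.eval a = MvPolynomial.eval (a • v) F := by
    intro a
    conv_rhs => rw [← MvPolynomial.sum_homogeneousComponent F]
    rw [map_sum, hq, Polynomial.eval_finsetSum]
    refine Finset.sum_congr rfl fun m _ => ?_
    rw [(MvPolynomial.homogeneousComponent_isHomogeneous m F).eval_smul, Polynomial.eval_monomial,
      mul_comm]
  have hq0 : q = 0 := by
    refine Polynomial.eq_zero_of_infinite_isRoot q ((Set.finite_singleton 0).infinite_compl.mono ?_)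
    intro a ha
    exact (hqe a).trans (h a ha)
  by_cases hn : n ≤ F.totalDegree
  · have := congrArg (fun p => Polynomial.coeff p n) hq0
    simpa [hq, Polynomial.finsetSum_coeff, Polynomial.coeff_monomial, Nat.lt_succ_iff, hn]
      using this
  · rw [MvPolynomial.homogeneousComponent_eq_zero _ _ (not_le.1 hn), map_zero]

theorem isHomogeneous_vanishingIdeal_puncturedCone {σ : Type*} (Z : Set (ℙ ℂ (σ → ℂ))) :
    (MvPolynomial.vanishingIdeal ℂ (puncturedCone Z)).IsHomogeneous
      (MvPolynomial.homogeneousSubmodule σ ℂ) := by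
  intro n F hF v hv
  refine (congrArg (MvPolynomial.aeval v)
    (MvPolynomial.decomposition.decompose'_apply F n)).trans ?_
  exact eval_homogeneousComponent_eq_zero
    (fun a ha => hF _ (smul_mem_puncturedCone hv ha)) n

theorem isPrime_vanishingIdeal_puncturedCone {σ : Type*} {Z : Set (ℙ ℂ (σ → ℂ))}
    (hZ : IsIrreducible Z) : (MvPolynomial.vanishingIdeal ℂ (puncturedCone Z)).IsPrime := by
  refine (isHomogeneous_vanishingIdeal_puncturedCone Z).isPrime_of_homogeneous_mem_or_mem ?_ ?_
  · obtain ⟨p, hp⟩ := hZ.nonempty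
    refine (Ideal.ne_top_iff_one _).2 fun h => ?_
    simpa using h _ (rep_mem_puncturedCone hp)
  · rintro F G ⟨m, hF⟩ ⟨n, hG⟩ hFG
    have hF' : ∀ H ∈ ({F} : Set (MvPolynomial σ ℂ)), ∃ n : ℕ, H.IsHomogeneous n := by
      rintro H rfl; exact ⟨m, hF⟩
    have hG' : ∀ H ∈ ({G} : Set (MvPolynomial σ ℂ)), ∃ n : ℕ, H.IsHomogeneous n := by
      rintro H rfl; exact ⟨n, hG⟩
    have hcover : Z ⊆ projZeroLocus {F} ∪ projZeroLocus {G} := by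
      intro p hp
      have h := hFG _ (rep_mem_puncturedCone hp)
      rw [map_mul, mul_eq_zero] at h
      refine h.imp ?_ ?_
      · rintro h H rfl; exact h
      · rintro h H rfl; exact h
    refine (isPreirreducible_iff_isClosed_union_isClosed.1 hZ.isPreirreducible _ _
      (isClosed_iff_isProjAlgebraicSet.2 ⟨_, hF', rfl⟩)
      (isClosed_iff_isProjAlgebraicSet.2 ⟨_, hG', rfl⟩) hcover).imp ?_ ?_
    · exact fun h => (subset_projZeroLocus_iff hF').1 h F rfl
    · exact fun h => (subset_projZeroLocus_iff hG').1 h G rfl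

/-- The vanishing ideal of a nonempty projective set lies strictly below the ideal of the vertex of
its cone. -/
theorem vanishingIdeal_puncturedCone_lt {σ : Type*} {Z : Set (ℙ ℂ (σ → ℂ))} (hZ : Z.Nonempty) :
    MvPolynomial.vanishingIdeal ℂ (puncturedCone Z) <
      RingHom.ker (MvPolynomial.constantCoeff (σ := σ) (R := ℂ)) := by
  obtain ⟨p, hp⟩ := hZ
  refine lt_of_le_of_ne (fun F hF => ?_) fun h => ?_
  · have := eval_homogeneousComponent_eq_zero
      (fun a ha => hF _ (smul_mem_puncturedCone (rep_mem_puncturedCone hp) ha)) 0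
    simpa [MvPolynomial.homogeneousComponent_zero, RingHom.mem_ker,
      MvPolynomial.constantCoeff_eq] using this
  · refine p.rep_nonzero (funext fun i => ?_)
    have : MvPolynomial.X i ∈ MvPolynomial.vanishingIdeal ℂ (puncturedCone Z) := by
      rw [h, RingHom.mem_ker, MvPolynomial.constantCoeff_X]
    simpa using this _ (rep_mem_puncturedCone hp)

/-- A set on whose cone every relation between the coordinates of a parametrization by `m`
variables holds has dimension less than `m`: the vanishing ideals of a chain of irreducible closed
subsets, and the ideal of the vertex of the cone, form a chain of primes of the coordinate ring. -/
theorem projDim_add_one_le_of_ker {σ τ : Type*} [Finite σ] [Finite τ]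
    (φ : MvPolynomial σ ℂ →ₐ[ℂ] MvPolynomial τ ℂ) {Z : Set (ℙ ℂ (σ → ℂ))}
    (hZ : ∀ F, φ F = 0 → ∀ v ∈ puncturedCone Z, MvPolynomial.eval v F = 0) :
    projDim Z + 1 ≤ (Nat.card τ : WithBot ℕ∞) := by
  change Order.krullDim (TopologicalSpace.IrreducibleCloseds Z) + 1 ≤ _
  rcases isEmpty_or_nonempty (TopologicalSpace.IrreducibleCloseds Z) with _ | _
  · rw [Order.krullDim_eq_bot]
    exact bot_le
  rw [← Order.krullDim_withBot]
  refine le_trans ?_ (ringKrullDim_quotient_ker_le φ)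
  rw [ringKrullDim_quotient, ← Order.krullDim_orderDual (α := PrimeSpectrum.zeroLocus _)]
  have himage (W : TopologicalSpace.IrreducibleCloseds Z) :
      IsIrreducible (Subtype.val '' (W : Set Z)) :=
    W.isIrreducible.image _ continuous_subtype_val.continuousOn
  have hker (W : Set Z) : RingHom.ker φ ≤
      MvPolynomial.vanishingIdeal ℂ (puncturedCone (Subtype.val '' W)) := by
    rintro F hF v ⟨hv, ⟨x, hx⟩, -, rfl⟩
    exact hZ F hF v ⟨hv, hx⟩
  let P : TopologicalSpace.IrreducibleCloseds Z → PrimeSpectrum.zeroLocus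
      ((RingHom.ker φ : Ideal (MvPolynomial σ ℂ)) : Set (MvPolynomial σ ℂ)) := fun W =>
    ⟨⟨_, isPrime_vanishingIdeal_puncturedCone (himage W)⟩, hker W⟩
  have hP : StrictAnti P := by
    intro W W' hlt
    have hle : (W : Set Z) ⊆ W' := hlt.le
    refine lt_of_le_not_ge ?_ fun hge => hlt.not_ge ?_
    · apply MvPolynomial.vanishingIdeal_anti_mono
      rintro v ⟨hv, hvW⟩
      exact ⟨hv, Set.image_mono hle hvW⟩
    · obtain ⟨C, hC, hCW⟩ := isClosed_induced_iff.1 W.isClosed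
      obtain ⟨S, hS, rfl⟩ := isClosed_iff_isProjAlgebraicSet.1 hC
      have h1 : Subtype.val '' (W : Set Z) ⊆ projZeroLocus S := by
        rw [← hCW]; exact Set.image_preimage_subset _ _
      have h2 : Subtype.val '' (W' : Set Z) ⊆ projZeroLocus S :=
        (subset_projZeroLocus_iff hS).2 fun F hF =>
          hge ((subset_projZeroLocus_iff hS).1 h1 F hF)
      intro x hx
      change x ∈ (W : Set Z)
      rw [← hCW]
      exact h2 ⟨x, hx, rfl⟩
  obtain ⟨W₀⟩ := ‹Nonempty (TopologicalSpace.IrreducibleCloseds Z)›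
  have hvertex (W : TopologicalSpace.IrreducibleCloseds Z) :=
    vanishingIdeal_puncturedCone_lt (himage W).nonempty
  let V : PrimeSpectrum.zeroLocus
      ((RingHom.ker φ : Ideal (MvPolynomial σ ℂ)) : Set (MvPolynomial σ ℂ)) :=
    ⟨⟨_, RingHom.ker_isPrime (MvPolynomial.constantCoeff (σ := σ) (R := ℂ))⟩,
      (hker W₀).trans (hvertex W₀).le⟩
  refine Order.krullDim_le_of_strictMono
    (fun W => WithBot.recBotCoe (OrderDual.toDual V) (fun W => OrderDual.toDual (P W)) W) ?_
  intro W W' hlt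
  induction W' with
  | bot => exact absurd hlt not_lt_bot
  | coe W' =>
    induction W with
    | bot => exact hvertex W'
    | coe W => exact hP (WithBot.coe_lt_coe.1 hlt)

/-! ### Images of polynomial maps -/

/-- The points of `ℙ(ℂ^σ)` that a family of polynomials parametrizes; the values of the parameters
at which the whole family vanishes are left out. -/
def paramImage {σ τ : Type*} (Φ : σ → MvPolynomial τ ℂ) : Set (ℙ ℂ (σ → ℂ)) :=
  {p | ∃ (t : τ → ℂ) (h : (fun s => MvPolynomial.eval t (Φ s)) ≠ 0),
    p = Projectivization.mk ℂ _ h}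

theorem eval_aeval_eq {σ τ : Type*} (Φ : σ → MvPolynomial τ ℂ) (F : MvPolynomial σ ℂ)
    (t : τ → ℂ) : MvPolynomial.eval t (MvPolynomial.aeval Φ F) =
      MvPolynomial.eval (fun s => MvPolynomial.eval t (Φ s)) F := by
  induction F using MvPolynomial.induction_on with
  | C a => simp
  | add p q hp hq => simp only [map_add, hp, hq]
  | mul_X p i hp => simp only [map_mul, hp, MvPolynomial.aeval_X, MvPolynomial.eval_X]

/-- The image of a polynomial map is irreducible, because the polynomial ring of the parameters is
a domain and polynomials are determined by their values. -/
theorem isIrreducible_paramImage {σ τ : Type*} {Φ : σ → MvPolynomial τ ℂ}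
    (h : (paramImage Φ).Nonempty) : IsIrreducible (paramImage Φ) := by
  refine ⟨h, isPreirreducible_iff_isClosed_union_isClosed.2 ?_⟩
  intro Z₁ Z₂ hZ₁ hZ₂ hcover
  obtain ⟨S, hS, rfl⟩ := isClosed_iff_isProjAlgebraicSet.1 hZ₁
  obtain ⟨T, hT, rfl⟩ := isClosed_iff_isProjAlgebraicSet.1 hZ₂
  have key {S : Set (MvPolynomial σ ℂ)} (hS : ∀ F ∈ S, ∃ n : ℕ, F.IsHomogeneous n)
      (hsub : ¬ paramImage Φ ⊆ projZeroLocus S) : ∃ F ∈ S, MvPolynomial.aeval Φ F ≠ 0 := by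
    by_contra! hF
    refine hsub ?_
    rintro _ ⟨t, ht, rfl⟩
    refine (mk_mem_projZeroLocus_iff hS _ ht).2 fun F hFS => ?_
    rw [← eval_aeval_eq, hF F hFS, map_zero]
  by_contra! hne
  obtain ⟨F, hF, hF0⟩ := key hS hne.1
  obtain ⟨G, hG, hG0⟩ := key hT hne.2
  obtain ⟨_, t₀, ht₀, -⟩ := h
  obtain ⟨s, hs⟩ := Function.ne_iff.1 ht₀
  have hs0 : Φ s ≠ 0 := by
    rintro hs0
    exact hs (by rw [hs0, map_zero]; rfl)
  refine mul_ne_zero hs0 (mul_ne_zero hF0 hG0) (MvPolynomial.funext fun t => ?_)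
  rw [map_zero, map_mul, map_mul, eval_aeval_eq, eval_aeval_eq]
  by_cases ht : (fun s => MvPolynomial.eval t (Φ s)) = 0
  · rw [congrFun ht s, Pi.zero_apply, zero_mul]
  · rcases hcover ⟨t, ht, rfl⟩ with hp | hp
    · rw [(mk_mem_projZeroLocus_iff hS _ ht).1 hp F hF, zero_mul, mul_zero]
    · rw [(mk_mem_projZeroLocus_iff hT _ ht).1 hp G hG, mul_zero, mul_zero]

/-- A chain of parametrized subsets of `Z`, on each of which some coordinate `c i` does not vanish
identically although it vanishes on all earlier ones, bounds the dimension from below. -/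
theorem le_projDim_of_paramImage {σ τ : Type*} {Z : Set (ℙ ℂ (σ → ℂ))} {n : ℕ}
    (Φ : ℕ → σ → MvPolynomial τ ℂ) (c : ℕ → σ)
    (hZ : ∀ i ≤ n, paramImage (Φ i) ⊆ Z)
    (hmono : ∀ i j, i ≤ j → j ≤ n → paramImage (Φ i) ⊆ paramImage (Φ j))
    (hne : ∀ i ≤ n, Φ i (c i) ≠ 0) (hzero : ∀ i j, i < j → j ≤ n → Φ i (c j) = 0) :
    (n : WithBot ℕ∞) ≤ projDim Z := by
  change _ ≤ Order.krullDim (TopologicalSpace.IrreducibleCloseds Z)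
  have hnonempty (i : ℕ) (hi : i ≤ n) : (paramImage (Φ i)).Nonempty := by
    by_contra h
    refine hne i hi (MvPolynomial.funext fun t => ?_)
    by_contra ht
    exact h ⟨_, t, fun h0 => ht (by rw [map_zero]; exact congrFun h0 (c i)), rfl⟩
  have hirr (i : ℕ) (hi : i ≤ n) :
      IsIrreducible ((Subtype.val : Z → _) ⁻¹' paramImage (Φ i)) := by
    have h := isIrreducible_paramImage (hnonempty i hi)
    obtain ⟨p, hp⟩ := h.nonempty
    refine ⟨⟨⟨p, hZ i hi hp⟩, hp⟩, isPreirreducible_iff_isClosed_union_isClosed.2 ?_⟩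
    intro C₁ C₂ hC₁ hC₂ hcover
    obtain ⟨D₁, hD₁, rfl⟩ := isClosed_induced_iff.1 hC₁
    obtain ⟨D₂, hD₂, rfl⟩ := isClosed_induced_iff.1 hC₂
    refine (isPreirreducible_iff_isClosed_union_isClosed.1 h.isPreirreducible D₁ D₂ hD₁ hD₂
      fun q hq => hcover (a := ⟨q, hZ i hi hq⟩) hq).imp ?_ ?_ <;>
    exact fun h => Set.preimage_mono h
  let W : Fin (n + 1) → TopologicalSpace.IrreducibleCloseds Z := fun i =>
    ⟨closure (Subtype.val ⁻¹' paramImage (Φ i)), (hirr i (Nat.lt_succ_iff.1 i.2)).closure,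
      isClosed_closure⟩
  have hW : StrictMono W := by
    intro i j hij
    have hj : (j : ℕ) ≤ n := Nat.lt_succ_iff.1 j.2
    refine lt_of_le_not_ge ?_ fun hge => ?_
    · exact closure_mono (Set.preimage_mono (hmono i j hij.le hj))
    · have hX : ∀ F ∈ ({MvPolynomial.X (c j)} : Set (MvPolynomial σ ℂ)),
          ∃ n : ℕ, F.IsHomogeneous n := by
        rintro _ rfl; exact ⟨1, MvPolynomial.isHomogeneous_X ℂ (c j)⟩
      have hcl : IsClosed ((Subtype.val : Z → _) ⁻¹' projZeroLocus {MvPolynomial.X (c j)}) :=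
        (isClosed_iff_isProjAlgebraicSet.2 ⟨_, hX, rfl⟩).preimage continuous_subtype_val
      have hi : closure (Subtype.val ⁻¹' paramImage (Φ i)) ⊆
          (Subtype.val : Z → _) ⁻¹' projZeroLocus {MvPolynomial.X (c j)} := by
        refine closure_minimal (Set.preimage_mono ?_) hcl
        rintro _ ⟨t, ht, rfl⟩
        refine (mk_mem_projZeroLocus_iff hX _ ht).2 ?_
        rintro _ rfl
        rw [MvPolynomial.eval_X, hzero i j hij hj, map_zero]
      refine hne j hj (MvPolynomial.funext fun t => ?_)
      by_contra ht
      have ht0 : (fun s => MvPolynomial.eval t (Φ j s)) ≠ 0 := fun h0 =>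
        ht (by rw [map_zero]; exact congrFun h0 (c j))
      have hmem : Projectivization.mk ℂ _ ht0 ∈ paramImage (Φ j) := ⟨t, ht0, rfl⟩
      have h := hi (hge (subset_closure (a := ⟨_, hZ j hj hmem⟩) hmem))
      have h := (mk_mem_projZeroLocus_iff hX _ ht0).1 h _ rfl
      rw [MvPolynomial.eval_X] at h
      exact ht (by rw [h, map_zero])
  exact Order.LTSeries.length_le_krullDim (LTSeries.mk n W hW)

/-! ### Common roots and common factors -/

theorem pointForm_isHomogeneous (v : Fin 2 → ℂ) : (pointForm v).IsHomogeneous 1 :=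
  ((MvPolynomial.isHomogeneous_X ℂ 0).C_mul _).sub ((MvPolynomial.isHomogeneous_X ℂ 1).C_mul _)

theorem eval_pointForm (v w : Fin 2 → ℂ) :
    MvPolynomial.eval w (pointForm v) = v 1 * w 0 - v 0 * w 1 := by
  simp [pointForm]

theorem pointForm_ne_zero {v : Fin 2 → ℂ} (hv : v ≠ 0) : pointForm v ≠ 0 := by
  intro h
  refine hv (funext fun i => ?_)
  fin_cases i
  · simpa [h] using eval_pointForm v ![0, 1]
  · simpa [h, eq_comm] using eval_pointForm v ![1, 0]

theorem irreducible_pointForm {v : Fin 2 → ℂ} (hv : v ≠ 0) : Irreducible (pointForm v) := by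
  refine MvPolynomial.irreducible_of_totalDegree_eq_one
    ((pointForm_isHomogeneous v).totalDegree (pointForm_ne_zero hv)) fun x hx => ?_
  refine isUnit_iff_ne_zero.2 ?_
  rintro rfl
  exact pointForm_ne_zero hv (MvPolynomial.ext _ _ fun m => by simpa using hx m)

theorem isRelPrime_pointForm_rep {p q : ℙ ℂ (Fin 2 → ℂ)} (hpq : p ≠ q) :
    IsRelPrime (pointForm p.rep) (pointForm q.rep) := by
  rw [(irreducible_pointForm p.rep_nonzero).isRelPrime_iff_not_dvd]
  rintro ⟨g, hg⟩
  have h : MvPolynomial.eval p.rep (pointForm q.rep) = 0 := by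
    rw [hg, map_mul, eval_pointForm, mul_comm (p.rep 1), sub_self, zero_mul]
  rw [eval_pointForm, sub_eq_zero] at h
  refine hpq ?_
  rw [← p.mk_rep, ← q.mk_rep, Projectivization.mk_eq_mk_iff']
  have hq := q.rep_nonzero
  by_cases h0 : q.rep 0 = 0
  · have h1 : q.rep 1 ≠ 0 := fun h1 => hq (funext fun i => by fin_cases i <;> assumption)
    refine ⟨p.rep 1 / q.rep 1, funext fun i => ?_⟩
    fin_cases i
    · have : p.rep 0 = 0 := by simpa [h0, h1] using h
      simp [h0, this]
    · simp [h1]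
  · refine ⟨p.rep 0 / q.rep 0, funext fun i => ?_⟩
    fin_cases i
    · simp [h0]
    · simp only [Fin.mk_one, Pi.smul_apply, smul_eq_mul]
      field_simp
      linear_combination h

/-- Forms have `n` common roots exactly when a product of `n` linear forms divides all of them:
linear forms of distinct points are coprime. -/
theorem hasCommonRoots_iff {ι : Type*} (f : ι → MvPolynomial (Fin 2) ℂ) (n : ℕ) :
    HasCommonRoots f n ↔ ∃ D : Multiset (ℙ ℂ (Fin 2 → ℂ)), Multiset.card D = n ∧
      ∀ i, (D.map fun q => pointForm q.rep).prod ∣ f i := by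
  classical
  constructor
  · rintro ⟨D, hD, hmult⟩
    obtain ⟨D', hD'⟩ : ∃ D', D' ∈ Multiset.powersetCard n D := by
      rw [← Multiset.card_pos_iff_exists_mem, Multiset.card_powersetCard]
      exact Nat.choose_pos hD
    obtain ⟨hle, hcard⟩ := Multiset.mem_powersetCard.1 hD'
    refine ⟨D', hcard, fun i => ?_⟩
    rw [Finset.prod_multiset_map_count]
    refine Finset.prod_dvd_of_isRelPrime
      (fun p _ q _ hpq => (isRelPrime_pointForm_rep hpq).pow) fun q _ => ?_
    refine pow_dvd_of_le_emultiplicity (le_trans ?_ (hmult i q))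
    convert (Nat.cast_le (α := ℕ∞)).2 (Multiset.count_le_of_le q hle)
  · rintro ⟨D, hD, hdvd⟩
    refine ⟨D, hD.ge, fun i q => le_emultiplicity_of_pow_dvd (dvd_trans ?_ (hdvd i))⟩
    have h : Multiset.replicate (D.count q) q ≤ D := Multiset.le_count_iff_replicate_le.1 le_rfl
    have := Multiset.prod_dvd_prod_of_le
      (Multiset.map_le_map (f := fun q : ℙ ℂ (Fin 2 → ℂ) => pointForm q.rep) h)
    rw [Multiset.map_replicate, Multiset.prod_replicate] at this
    convert this

theorem pointForm_mk_rep_associated (v : Fin 2 → ℂ) (hv : v ≠ 0) :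
    Associated (pointForm (Projectivization.mk ℂ v hv).rep) (pointForm v) := by
  obtain ⟨a, ha⟩ := Projectivization.exists_smul_eq_mk_rep ℂ v hv
  have key : pointForm ((a : ℂ) • v) = MvPolynomial.C (a : ℂ) * pointForm v := by
    simp only [pointForm, Pi.smul_apply, smul_eq_mul, map_mul]
    ring
  rw [← ha, Units.smul_def, key]
  exact associated_unit_mul_left _ _ (a.isUnit.map MvPolynomial.C)

/-! ### Tuples with a prescribed common factor -/

open Polynomial in
/-- The tuple of coefficients of the binary forms of degree `d`
`∏ l, (v l 1 * x - v l 0 * y) * ∑ m, h (i, m) * x ^ m * y ^ (k - 1 - m)`, for `e + k = d + 1`. They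
are read off after `y` is set to `1`: the coordinate `j` is the coefficient of `x ^ (d - j)`. They may
lie in any commutative ring, in particular be indeterminates. -/
noncomputable def factoredTuple {R : Type*} [CommRing R] {e k r : ℕ} (d : ℕ) (v : Fin e → Fin 2 → R)
    (h : Fin (r + 1) × Fin k → R) (s : Fin (r + 1) × Fin (d + 1)) : R :=
  ((∏ l, (C (v l 1) * X - C (v l 0))) * ∑ m : Fin k, C (h (s.1, m)) * X ^ (m : ℕ)).coeff
    (d - (s.2 : ℕ))

theorem map_factoredTuple {R S : Type*} [CommRing R] [CommRing S] (φ : R →+* S) {e k r d : ℕ}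
    (v : Fin e → Fin 2 → R) (h : Fin (r + 1) × Fin k → R) (s : Fin (r + 1) × Fin (d + 1)) :
    φ (factoredTuple d v h s) = factoredTuple d (fun l j => φ (v l j)) (fun t => φ (h t)) s := by
  simp only [factoredTuple, ← Polynomial.coeff_map, Polynomial.map_mul, Polynomial.map_prod,
    Polynomial.map_sum, Polynomial.map_sub, Polynomial.map_pow, Polynomial.map_C, Polynomial.map_X]

theorem binaryForm_coeff (p : Polynomial ℂ) (d : ℕ) :
    binaryForm (fun j : Fin (d + 1) => p.coeff (d - j)) = p.homogenize d := by
  rw [binaryForm, Polynomial.homogenize, ← Finset.Nat.sum_antidiagonal_swap,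
    Finset.Nat.sum_antidiagonal_eq_sum_range_succ_mk, ← Fin.sum_univ_eq_sum_range]
  refine Finset.sum_congr rfl fun j _ => ?_
  rw [MvPolynomial.monomial_eq, Finsupp.prod_fintype _ _ (by simp)]
  simp

theorem natDegree_linear_le {R : Type*} [CommRing R] (a b : R) :
    (Polynomial.C a * Polynomial.X - Polynomial.C b).natDegree ≤ 1 := by
  compute_degree

theorem natDegree_sum_fin_le {R : Type*} [CommRing R] {k : ℕ} (h : Fin (k + 1) → R) :
    (∑ m : Fin (k + 1), Polynomial.C (h m) * Polynomial.X ^ (m : ℕ)).natDegree ≤ k :=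
  Polynomial.natDegree_sum_le_of_forall_le _ _ fun m _ =>
    (Polynomial.natDegree_C_mul_X_pow_le _ _).trans (Nat.lt_succ_iff.1 m.2)

theorem homogenize_linear (v : Fin 2 → ℂ) :
    (Polynomial.C (v 1) * Polynomial.X - Polynomial.C (v 0)).homogenize 1 = pointForm v := by
  rw [Polynomial.homogenize_sub, Polynomial.homogenize_C_mul, Polynomial.homogenize_X one_ne_zero,
    Polynomial.homogenize_C]
  simp [pointForm]

theorem mk_factoredTuple_mem_stratum {d r k : ℕ} (hk : 1 ≤ k) (hkd : k ≤ d)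
    (v : Fin (d - k + 1) → Fin 2 → ℂ) (hv : ∀ l, v l ≠ 0) (h : Fin (r + 1) × Fin k → ℂ)
    (hne : factoredTuple d v h ≠ 0) : Projectivization.mk ℂ _ hne ∈ stratum d r k := by
  obtain ⟨k, rfl⟩ : ∃ k', k = k' + 1 := ⟨k - 1, by omega⟩
  rw [mk_mem_stratum_iff, hasCommonRoots_iff]
  refine ⟨Finset.univ.val.map fun l => Projectivization.mk ℂ (v l) (hv l), by simp, fun i => ?_⟩
  rw [Multiset.map_map]
  refine (Associated.prod Finset.univ _ _
    fun l _ => pointForm_mk_rep_associated (v l) (hv l)).dvd.trans ?_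
  simp only [factoredTuple]
  rw [binaryForm_coeff]
  simp only [← homogenize_linear]
  have hmul := Polynomial.homogenize_mul
    (∏ l, (Polynomial.C (v l 1) * Polynomial.X - Polynomial.C (v l 0)))
    (∑ m, Polynomial.C (h (i, m)) * Polynomial.X ^ (m : ℕ))
    ((Polynomial.natDegree_prod_le _ _).trans
      (Finset.sum_le_sum fun l _ => natDegree_linear_le (v l 1) (v l 0)))
    (natDegree_sum_fin_le _)
  have hsum : ∑ l : Fin (d - (k + 1) + 1), 1 + k = d := by simp; omega
  rw [hsum, Polynomial.homogenize_finsetProd fun l _ => natDegree_linear_le _ _] at hmul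
  rw [hmul]
  exact dvd_mul_right _ _

/-- A tuple of binary forms is obtained from its common roots and the complementary factors. -/
theorem exists_eq_factoredTuple {d r k : ℕ} (hk : 1 ≤ k) (hkd : k ≤ d)
    {s : Fin (r + 1) × Fin (d + 1) → ℂ} (hs : s ∈ puncturedCone (stratum d r k)) :
    ∃ (v : Fin (d - k + 1) → Fin 2 → ℂ) (h : Fin (r + 1) × Fin k → ℂ),
      s = factoredTuple d v h := by
  obtain ⟨hs0, hs⟩ := hs
  rw [mk_mem_stratum_iff, hasCommonRoots_iff] at hs
  obtain ⟨D, hD, hdvd⟩ := hs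
  induction D using Quotient.inductionOn with | _ L => ?_
  simp only [Multiset.quot_mk_to_coe, Multiset.coe_card, Multiset.map_coe,
    Multiset.prod_coe] at hD hdvd
  let v : Fin (d - k + 1) → Fin 2 → ℂ := fun l => (L.get (l.cast hD.symm)).rep
  have hG : (L.map fun q => pointForm q.rep).prod = ∏ l, pointForm (v l) := by
    rw [← Fin.prod_univ_fun_getElem, ← Equiv.prod_comp (finCongr hD.symm)]
    rfl
  set G := ∏ l, pointForm (v l) with hGdef
  have hG0 : G ≠ 0 := Finset.prod_ne_zero_iff.2 fun l _ =>
    pointForm_ne_zero (Projectivization.rep_nonzero _)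
  have hGdeg : G.totalDegree = d - k + 1 := by
    refine MvPolynomial.IsHomogeneous.totalDegree ?_ hG0
    simpa using MvPolynomial.IsHomogeneous.prod Finset.univ (fun l => pointForm (v l)) (fun _ => 1)
      fun l _ => pointForm_isHomogeneous (v l)
  have key : ∀ i, ∃ q : Polynomial ℂ, q.natDegree < k ∧
      ∑ j : Fin (d + 1), Polynomial.C (s (i, j)) * Polynomial.X ^ (d - (j : ℕ)) =
      (∏ l, (Polynomial.C (v l 1) * Polynomial.X - Polynomial.C (v l 0))) * q := by
    intro i
    have hf : MvPolynomial.aeval ![(Polynomial.X : Polynomial ℂ), 1]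
        (binaryForm fun j => s (i, j)) =
        ∑ j : Fin (d + 1), Polynomial.C (s (i, j)) * Polynomial.X ^ (d - (j : ℕ)) := by
      simp [binaryForm]
    by_cases hz : (binaryForm fun j => s (i, j)) = 0
    · exact ⟨0, by rw [Polynomial.natDegree_zero]; exact hk, by rw [← hf, hz, map_zero, mul_zero]⟩
    obtain ⟨H, hH⟩ := hdvd i
    rw [hG] at hH
    have hH0 : H ≠ 0 := by rintro rfl; exact hz (by rw [hH, mul_zero])
    have hdeg : (binaryForm fun j => s (i, j)).totalDegree ≤ d := by
      refine MvPolynomial.totalDegree_finsetSum_le fun j _ => ?_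
      refine MvPolynomial.IsHomogeneous.totalDegree_le ?_
      have := (((MvPolynomial.isHomogeneous_X ℂ (0 : Fin 2)).pow (d - j)).mul
        ((MvPolynomial.isHomogeneous_X ℂ (1 : Fin 2)).pow j)).C_mul (s (i, j))
      convert this using 1
      have := j.2
      omega
    rw [hH, MvPolynomial.totalDegree_mul_of_isDomain hG0 hH0, hGdeg] at hdeg
    refine ⟨MvPolynomial.aeval ![Polynomial.X, 1] H, ?_, ?_⟩
    · have := MvPolynomial.aeval_natDegree_le (m := k - 1) (n := 1) H (by omega)
        ![(Polynomial.X : Polynomial ℂ), 1] (by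
          intro j; fin_cases j <;> simp)
      omega
    · rw [← hf, hH, map_mul, hGdef, map_prod]
      simp [pointForm]
  choose q hqdeg hq using key
  refine ⟨v, fun t => (q t.1).coeff t.2, funext fun ⟨i, j⟩ => ?_⟩
  have hsum : ∑ m : Fin k, Polynomial.C ((q i).coeff m) * Polynomial.X ^ (m : ℕ) = q i := by
    rw [Fin.sum_univ_eq_sum_range
      (fun m => Polynomial.C ((q i).coeff m) * Polynomial.X ^ m)]
    exact ((q i).as_sum_range_C_mul_X_pow' (hqdeg i)).symm
  rw [factoredTuple]
  simp only
  rw [hsum, ← hq i, Polynomial.finsetSum_coeff, Finset.sum_eq_single j]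
  · simp
  · intro j' _ hj'
    rw [Polynomial.coeff_C_mul_X_pow, if_neg]
    intro h
    exact hj' (Fin.ext (by have := j.2; have := j'.2; omega))
  · simp

/-! ### The parametrization of a stratum -/

/-- The tuple of forms `∏ l, (b l * x + y) * h i`, where the family of parameters `t` lists
the `b l` and then the coefficients of the `h i`. The linear factors of a general common
factor can be normalized in this way if the constants are moved into `h`. -/
noncomputable def normalizedTuple {R : Type*} [CommRing R] {e k r : ℕ} (d : ℕ)
    (t : Fin e ⊕ (Fin (r + 1) × Fin k) → R) : Fin (r + 1) × Fin (d + 1) → R :=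
  factoredTuple d (fun l => ![-1, t (.inl l)]) fun s => t (.inr s)

theorem map_normalizedTuple {R S : Type*} [CommRing R] [CommRing S] (φ : R →+* S) {e k r d : ℕ}
    (y : Fin e ⊕ (Fin (r + 1) × Fin k) → R) (s : Fin (r + 1) × Fin (d + 1)) :
    φ (normalizedTuple d y s) = normalizedTuple d (fun t => φ (y t)) s := by
  rw [normalizedTuple, map_factoredTuple, normalizedTuple]
  congr 1
  funext l j
  fin_cases j <;> simp

theorem exists_factoredTuple_eq_normalizedTuple {K : Type*} [Field K] {e k r : ℕ} (d : ℕ)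
    {v : Fin e → Fin 2 → K} (hv : ∀ l, v l 0 ≠ 0) (h : Fin (r + 1) × Fin k → K) :
    ∃ y : Fin e ⊕ (Fin (r + 1) × Fin k) → K, factoredTuple d v h = normalizedTuple d y := by
  refine ⟨Sum.elim (fun l => -(v l 1 / v l 0)) fun t => (∏ l, -v l 0) * h t, funext fun s => ?_⟩
  simp only [normalizedTuple, factoredTuple, Sum.elim_inl, Sum.elim_inr]
  congr 1
  have h1 : ∀ l, (Polynomial.C (v l 1) * Polynomial.X - Polynomial.C (v l 0) : Polynomial K) =
      Polynomial.C (-v l 0) * (Polynomial.C (![-1, -(v l 1 / v l 0)] 1) * Polynomial.X -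
        Polynomial.C (![-1, -(v l 1 / v l 0)] 0)) := by
    intro l
    have h2 : v l 1 = -v l 0 * -(v l 1 / v l 0) := by have := hv l; field_simp
    conv_lhs => rw [h2]
    simp only [map_mul, map_neg, Matrix.cons_val_zero, Matrix.cons_val_one, map_one]
    ring
  rw [Finset.prod_congr rfl fun l _ => h1 l, Finset.prod_mul_distrib, ← map_prod]
  simp only [map_mul, mul_assoc, ← Finset.mul_sum]
  ring

/-- A relation between the coordinates of the normalized tuples holds for all tuples with
a common factor of the given degree: the tuples that cannot be normalized are limits of
those that can. -/
theorem eval_factoredTuple_eq_zero {e k r d : ℕ}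
    {F : MvPolynomial (Fin (r + 1) × Fin (d + 1)) ℂ}
    (hF : MvPolynomial.aeval (normalizedTuple d
      (MvPolynomial.X (R := ℂ) (σ := Fin e ⊕ (Fin (r + 1) × Fin k)))) F = 0)
    (v : Fin e → Fin 2 → ℂ) (h : Fin (r + 1) × Fin k → ℂ) :
    MvPolynomial.eval (factoredTuple d v h) F = 0 := by
  have hnorm (y : Fin e ⊕ (Fin (r + 1) × Fin k) → ℂ) :
      MvPolynomial.eval (normalizedTuple d y) F = 0 := by
    have := eval_aeval_eq (normalizedTuple d
      (MvPolynomial.X (R := ℂ) (σ := Fin e ⊕ (Fin (r + 1) × Fin k)))) F y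
    simpa only [hF, map_zero, map_normalizedTuple, MvPolynomial.eval_X, eq_comm] using this
  -- Move the points `v l` along a line; the value of `F` is a polynomial in the parameter.
  let w : Fin e → Fin 2 → Polynomial ℂ := fun l =>
    ![Polynomial.C (v l 0) + Polynomial.X, Polynomial.C (v l 1)]
  let q : Polynomial ℂ := MvPolynomial.aeval (factoredTuple d w fun t => Polynomial.C (h t)) F
  have hq (a : ℂ) : q.eval a =
      MvPolynomial.eval (factoredTuple d (fun l => ![v l 0 + a, v l 1]) h) F := by
    have h1 := MvPolynomial.comp_aeval_apply (factoredTuple d w fun t => Polynomial.C (h t))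
      (Polynomial.aeval a) F
    rw [Polynomial.coe_aeval_eq_eval] at h1
    refine h1.trans ?_
    rw [← MvPolynomial.coe_aeval_eq_eval]
    refine congrArg (fun x => MvPolynomial.aeval x F) (funext fun s => ?_)
    refine (map_factoredTuple (Polynomial.evalRingHom a) w _ s).trans ?_
    congr 1
    · funext l j
      fin_cases j <;> simp [w]
    · simp
  have hq0 : q = 0 := by
    refine Polynomial.eq_zero_of_infinite_isRoot q
      ((Set.finite_range fun l => -v l 0).infinite_compl.mono fun a ha => ?_)
    obtain ⟨y, hy⟩ := exists_factoredTuple_eq_normalizedTuple d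
      (v := fun l => ![v l 0 + a, v l 1])
      (fun l hl => ha ⟨l, (eq_neg_of_add_eq_zero_right (by simpa using hl)).symm⟩) h
    rw [Set.mem_ofPred_eq, Polynomial.IsRoot.def, hq, hy, hnorm]
  have h0 := hq 0
  rw [hq0, Polynomial.eval_zero] at h0
  convert h0.symm using 4
  funext l j
  fin_cases j <;> simp

theorem projDim_stratum_le (d r k : ℕ) (hk : 1 ≤ k) (hkd : k ≤ d) :
    projDim (stratum d r k) ≤ ((d + k * r : ℕ) : WithBot ℕ∞) := by
  have h := projDim_add_one_le_of_ker (Z := stratum d r k)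
    (MvPolynomial.aeval (normalizedTuple d
      (MvPolynomial.X (R := ℂ) (σ := Fin (d - k + 1) ⊕ (Fin (r + 1) × Fin k))))) (by
      intro F hF s hs
      obtain ⟨v, h, rfl⟩ := exists_eq_factoredTuple hk hkd hs
      exact eval_factoredTuple_eq_zero hF v h)
  have hcard : Nat.card (Fin (d - k + 1) ⊕ (Fin (r + 1) × Fin k)) = d + k * r + 1 := by
    simp only [Nat.card_eq_fintype_card, Fintype.card_sum, Fintype.card_prod, Fintype.card_fin]
    have : (r + 1) * k = k * r + k := by ring
    omega
  rw [hcard, Nat.cast_add, Nat.cast_one] at h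
  exact ENat.WithBot.add_le_add_one_right_iff.1 h

/-! ### A chain of subvarieties of a stratum -/

/-- An ordering of the parameters `(b, h)`: the coefficient `h (0, 0)` comes first, then the `b l`,
then the other coefficients of `h` in lexicographic order. -/
def paramRank {e k r : ℕ} : Fin e ⊕ (Fin (r + 1) × Fin k) → ℕ
  | .inl l => l + 1
  | .inr t => if (t.1 : ℕ) = 0 ∧ (t.2 : ℕ) = 0 then 0 else e + t.1 * k + t.2

/-- The parameters of rank greater than `c` set to zero. -/
def truncateParams {e k r : ℕ} {R : Type*} [Zero R] (c : ℕ)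
    (y : Fin e ⊕ (Fin (r + 1) × Fin k) → R) (t : Fin e ⊕ (Fin (r + 1) × Fin k)) : R :=
  if paramRank t ≤ c then y t else 0

theorem coeff_mul_sum_eq_zero {R : Type*} [CommRing R] {k : ℕ} {g : Polynomial R}
    {h : Fin k → R} {N : ℕ} (hN : ∀ m, h m ≠ 0 → g.natDegree + m < N) :
    (g * ∑ m : Fin k, Polynomial.C (h m) * Polynomial.X ^ (m : ℕ)).coeff N = 0 := by
  rw [Finset.mul_sum, Polynomial.finsetSum_coeff]
  refine Finset.sum_eq_zero fun m _ => ?_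
  by_cases hm : h m = 0
  · simp [hm]
  · refine Polynomial.coeff_eq_zero_of_natDegree_lt (lt_of_le_of_lt ?_ (hN m hm))
    exact Polynomial.natDegree_mul_le.trans
      (Nat.add_le_add_left (Polynomial.natDegree_C_mul_X_pow_le _ _) _)

/-- The coordinate that separates the `c`-th member of the chain from the earlier ones: the top
coefficient of the form in which the parameter of rank `c` occurs. The truncated subtraction makes
this the form `0` for all `c ≤ d - k + 1`, where the parameter is `h (0, 0)` or some `b l`. -/
def chainCoord (d r k c : ℕ) : Fin (r + 1) × Fin (d + 1) :=
  (Fin.ofNat (r + 1) ((c - (d - k + 1)) / k),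
    Fin.ofNat (d + 1) (d - (min c (d - k + 1) + (c - (d - k + 1)) % k)))

theorem chainCoord_spec {d r k c : ℕ} (hk : 1 ≤ k) (hkd : k ≤ d) (hc : c ≤ d + k * r) :
    ((chainCoord d r k c).1 : ℕ) = (c - (d - k + 1)) / k ∧
      d - ((chainCoord d r k c).2 : ℕ) = min c (d - k + 1) + (c - (d - k + 1)) % k := by
  have h1 : (c - (d - k + 1)) / k < r + 1 := by
    rw [Nat.div_lt_iff_lt_mul hk]
    have : (r + 1) * k = k * r + k := by ring
    omega
  have h2 := Nat.mod_lt (c - (d - k + 1)) hk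
  simp only [chainCoord, Fin.val_ofNat]
  rw [Nat.mod_eq_of_lt h1, Nat.mod_eq_of_lt (by omega)]
  exact ⟨rfl, by omega⟩

theorem normalizedTuple_truncateParams_chainCoord_eq_zero {R : Type*} [CommRing R] {d r k i c : ℕ}
    (hk : 1 ≤ k) (hkd : k ≤ d) (hic : i < c) (hc : c ≤ d + k * r)
    (y : Fin (d - k + 1) ⊕ (Fin (r + 1) × Fin k) → R) :
    normalizedTuple d (truncateParams i y) (chainCoord d r k c) = 0 := by
  obtain ⟨h1, h2⟩ := chainCoord_spec hk hkd hc
  rw [normalizedTuple, factoredTuple, h2]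
  refine coeff_mul_sum_eq_zero fun m hm => ?_
  have hdeg : (∏ l : Fin (d - k + 1), (Polynomial.C (![-1, truncateParams i y (.inl l)] 1) *
      Polynomial.X - Polynomial.C (![-1, truncateParams i y (.inl l)] 0))).natDegree ≤
      min i (d - k + 1) := by
    refine (Polynomial.natDegree_prod_le _ _).trans ?_
    refine (Finset.sum_le_sum (g := fun l : Fin (d - k + 1) => if (l : ℕ) < i then 1 else 0)
      fun l _ => ?_).trans ?_
    · simp only [truncateParams, paramRank, Nat.succ_le_iff]
      split_ifs
      · exact natDegree_linear_le _ _
      · simp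
    · rw [Fin.sum_univ_eq_sum_range (fun l => if l < i then 1 else 0), ← Finset.card_filter]
      refine le_min ?_ ?_
      · exact (Finset.card_le_card (t := Finset.range i) (by intro l; simp)).trans (by simp)
      · exact (Finset.card_filter_le _ _).trans (by simp)
  have hrank : paramRank (e := d - k + 1) (.inr ((chainCoord d r k c).1, m)) ≤ i := by
    by_contra hlt
    exact hm (if_neg hlt)
  have hdiv := Nat.div_add_mod' (c - (d - k + 1)) k
  have hmod := Nat.mod_lt (c - (d - k + 1)) hk
  simp only [paramRank, h1] at hrank
  generalize (c - (d - k + 1)) / k = a at *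
  generalize (c - (d - k + 1)) % k = b at *
  split_ifs at hrank with h0
  · obtain ⟨rfl, hm0⟩ := h0
    omega
  · by_cases hce : c ≤ d - k + 1
    · rw [not_and] at h0
      omega
    · omega

theorem normalizedTuple_truncateParams_X_chainCoord_ne_zero {d r k c : ℕ} (hk : 1 ≤ k)
    (hkd : k ≤ d) (hc : c ≤ d + k * r) :
    normalizedTuple d (truncateParams c (MvPolynomial.X (R := ℂ)
      (σ := Fin (d - k + 1) ⊕ (Fin (r + 1) × Fin k)))) (chainCoord d r k c) ≠ 0 := by
  obtain ⟨h1, h2⟩ := chainCoord_spec hk hkd hc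
  have hmod := Nat.mod_lt (c - (d - k + 1)) hk
  have hdiv := Nat.div_add_mod' (c - (d - k + 1)) k
  intro h
  -- Evaluated at these parameters, the form in question is `(x + 1) ^ min c e * x ^ m`, with
  -- `m = (c - e) % k`.
  have h := congrArg (MvPolynomial.eval (Sum.elim (fun _ => 1)
    fun t => if t.2 = ⟨_, hmod⟩ then 1 else 0)) h
  rw [map_normalizedTuple, map_zero, normalizedTuple, factoredTuple, h2] at h
  have hprod : ∀ l : Fin (d - k + 1), MvPolynomial.eval (Sum.elim (fun _ => 1)
      fun t : Fin (r + 1) × Fin k => if t.2 = ⟨_, hmod⟩ then (1 : ℂ) else 0)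
      (truncateParams c (MvPolynomial.X (R := ℂ)) (.inl l)) = if (l : ℕ) < c then 1 else 0 := by
    intro l
    simp only [truncateParams, paramRank, Nat.succ_le_iff]
    split_ifs <;> simp
  have hsum : ∀ m : Fin k, MvPolynomial.eval (Sum.elim (fun _ : Fin (d - k + 1) => 1)
      fun t : Fin (r + 1) × Fin k => if t.2 = ⟨_, hmod⟩ then (1 : ℂ) else 0)
      (truncateParams c (MvPolynomial.X (R := ℂ)) (.inr ((chainCoord d r k c).1, m))) =
      if m = ⟨_, hmod⟩ then 1 else 0 := by
    intro m
    by_cases hm : m = ⟨_, hmod⟩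
    · have : paramRank (e := d - k + 1) (.inr ((chainCoord d r k c).1, m)) ≤ c := by
        have := Nat.le_mul_of_pos_right ((c - (d - k + 1)) / k) hk
        simp only [paramRank, h1, hm]
        split_ifs <;> omega
      rw [truncateParams, if_pos this, MvPolynomial.eval_X, Sum.elim_inr]
    · simp only [truncateParams]
      split_ifs <;> simp [hm]
  have hfac : (∏ l : Fin (d - k + 1), (Polynomial.C (![-1, if (l : ℕ) < c then (1 : ℂ) else 0] 1) *
      Polynomial.X - Polynomial.C (![-1, if (l : ℕ) < c then (1 : ℂ) else 0] 0))) =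
      (Polynomial.X + Polynomial.C 1) ^ min c (d - k + 1) := by
    have : ∀ l : Fin (d - k + 1), (Polynomial.C (![-1, if (l : ℕ) < c then (1 : ℂ) else 0] 1) *
      Polynomial.X - Polynomial.C (![-1, if (l : ℕ) < c then (1 : ℂ) else 0] 0)) =
      if (l : ℕ) < c then Polynomial.X + Polynomial.C 1 else 1 := by
      intro l
      split_ifs <;> simp
    rw [Finset.prod_congr rfl fun l _ => this l,
      Fin.prod_univ_eq_prod_range (fun l =>
        if l < c then Polynomial.X + Polynomial.C (1 : ℂ) else 1),
      ← Finset.prod_filter, Finset.prod_const]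
    congr 1
    rw [← Finset.card_range (min c (d - k + 1))]
    congr 1
    ext l
    simp [and_comm]
  simp only [hprod, hsum, hfac] at h
  rw [Finset.sum_eq_single ⟨_, hmod⟩ (by intro m _ hm; simp [hm]) (by simp), if_pos rfl,
    map_one, one_mul] at h
  have hmonic : ((Polynomial.X + Polynomial.C (1 : ℂ)) ^ min c (d - k + 1) *
      Polynomial.X ^ ((c - (d - k + 1)) % k)).Monic :=
    ((Polynomial.monic_X_add_C 1).pow _).mul (Polynomial.monic_X_pow _)
  have hdeg : ((Polynomial.X + Polynomial.C (1 : ℂ)) ^ min c (d - k + 1) *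
      Polynomial.X ^ ((c - (d - k + 1)) % k)).natDegree =
      min c (d - k + 1) + (c - (d - k + 1)) % k := by
    rw [((Polynomial.monic_X_add_C 1).pow _).natDegree_mul (Polynomial.monic_X_pow _),
      (Polynomial.monic_X_add_C 1).natDegree_pow, Polynomial.natDegree_X_add_C,
      Polynomial.natDegree_X_pow, mul_one]
  have := hmonic.coeff_natDegree
  rw [hdeg, map_one] at this
  exact zero_ne_one (h.symm.trans this)

theorem le_projDim_stratum (d r k : ℕ) (hk : 1 ≤ k) (hkd : k ≤ d) :
    ((d + k * r : ℕ) : WithBot ℕ∞) ≤ projDim (stratum d r k) := by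
  have heval (c : ℕ) (t : Fin (d - k + 1) ⊕ (Fin (r + 1) × Fin k) → ℂ) :
      (fun s => MvPolynomial.eval t (normalizedTuple d (truncateParams c MvPolynomial.X) s)) =
        normalizedTuple d (truncateParams c t) := by
    funext s
    rw [map_normalizedTuple]
    congr 1
    funext u
    simp only [truncateParams]
    split_ifs <;> simp
  refine le_projDim_of_paramImage
    (fun c => normalizedTuple d (truncateParams c (MvPolynomial.X (R := ℂ)
      (σ := Fin (d - k + 1) ⊕ (Fin (r + 1) × Fin k))))) (chainCoord d r k) ?_ ?_ ?_ ?_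
  · rintro c - _ ⟨t, ht, rfl⟩
    simp only [heval] at ht ⊢
    exact mk_factoredTuple_mem_stratum hk hkd _
      (fun l h0 => by simpa using congrFun h0 0) _ ht
  · rintro i j hij - _ ⟨t, ht, rfl⟩
    have htr : truncateParams j (truncateParams i t) = truncateParams i t := by
      funext u
      simp only [truncateParams]
      split_ifs <;> first | rfl | omega
    refine ⟨truncateParams i t, ?_, ?_⟩
    · rw [heval, htr, ← heval]; exact ht
    · simp only [heval, htr]
  · exact fun c hc => normalizedTuple_truncateParams_X_chainCoord_ne_zero hk hkd hc
  · exact fun i c hic hc => normalizedTuple_truncateParams_chainCoord_eq_zero hk hkd hic hc _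

theorem lemma2p2 (d r k : ℕ) (hk : 1 ≤ k) (hkd : k ≤ d) :
    projDim (stratum d r k) = ((d + k * r : ℕ) : WithBot ℕ∞) :=
  le_antisymm (projDim_stratum_le d r k hk hkd) (le_projDim_stratum d r k hk hkd)
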